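/- **Proposition.** Let $\mathcal C,\mathcal D$ be quasicategories, let $g\colon\mathcal D\to\mathcal C$ be a functor, and let $p\colon\mathcal M\to\Delta^1$ be a cartesian fibration which classifies $g$ via $v$. That is, we are given isomorphisms $\mathcal C\cong\mathcal M_0$ and $\mathcal D\cong\mathcal M_1$ with the fibres of $p$ (suppressed from the notation), and a map $v\colon\mathcal D\times\Delta^1\to\mathcal M$ over $\Delta^1$ such that $v|_{\mathcal D\times\{0\}}=g$, $v|_{\mathcal D\times\{1\}}=\mathrm{id}_{\mathcal D}$, and for every vertex $d$ of $\mathcal D$ the edge $v|_{\{d\}\times\Delta^1}$ is $p$-cartesian. *Definitions.* We say that $g$ admits a left adjoint at a vertex $c$ of $\mathcal C$ if there is a $p$-cocartesian edge of $\mathcal M$ over the edge $0\to1$ of $\Delta^1$ with source $c\in\mathcal M_0$. For a map of simplicial sets $s\colon K\to\Delta^1$ with fibres $K_0,K_1$, we say that maps $\alpha\colon K\to\mathcal C$ and $\tilde\alpha\colon K\to\mathcal D$ are adjunct relative to $s$ if there is a map $A\colon K\times\Delta^1\to\mathcal M$ with $p\circ A=\mathrm{pr}_{\Delta^1}$ such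 that 1. $A|_{K\times\{0\}}=\alpha$; 2. $A|_{K\times\{1\}}=\tilde\alpha$; 3. for every vertex $k$ of $K_0$, the edge $A|_{\{k\}\times\Delta^1}$ of $\mathcal M$ is $p$-cocartesian; 4. $A|_{K_1\times\Delta^1}$ equals the composite $K_1\times\Delta^1\hookrightarrow K\times\Delta^1\xrightarrow{\tilde\alpha\times\mathrm{id}}\mathcal D\times\Delta^1\xrightarrow{v}\mathcal M$. *Statement.* Let $s\colon K\to\Delta^1$ be a map of simplicial sets, and let $i\colon K'\to K$ be a monomorphism which induces an isomorphism $K'_1\to K_1$ between the fibres of $s\circ i$ and $s$ over the vertex $1$. Let $\alpha\colon K\to\mathcal C$ and $\tilde\alpha'\colon K'\to\mathcal D$ be maps such that $\tilde\alpha'$ is adjunct to $\alpha'=\alpha\circ i$ relative to $s\circ i$. Suppose that $g$ admits a left adjoint at every vertex of $\mathcal C$ of the form $\alpha(k)$ with $k$ a vertex of $K_0$. Then there exists a map $\tilde\alpha\colon K\to\mathcal D$ with $\tilde\alpha\circ i=\tilde\alpha'$ which is adjunct to $\alpha$ relative to $s$. Furthermore, any two maps $\tilde\alpha$ with these properties are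 equivalent as functors $K\to\mathcal D$, i.e. as objects of the quasicategory $\mathrm{Fun}(K,\mathcal D)$. -/

import Mathlib

open CategoryTheory MonoidalCategory Simplicial Opposite

universe u

namespace AdjunctData

/-! ### Cartesian and cocartesian edges, cartesian fibrations -/

/-- The edge `{0, 1}` of the outer horn `Λ[n + 2, 0]`. -/
def firstEdge (n : ℕ) : (Λ[n + 2, 0] : SSet.{u}) _⦋1⦌ :=
  SSet.horn.edge (n + 2) 0 0 1 (Fin.zero_le _)
    (by rw [Finset.insert_eq_of_mem (by simp)]; exact Finset.card_le_two.trans (by omega))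

/-- The edge `{n + 1, n + 2}` of the outer horn `Λ[n + 2, n + 2]`. -/
def lastEdge (n : ℕ) : (Λ[n + 2, Fin.last (n + 2)] : SSet.{u}) _⦋1⦌ :=
  SSet.horn.edge (n + 2) (Fin.last (n + 2)) (Fin.last (n + 1)).castSucc (Fin.last (n + 2))
    (Fin.le_last _)
    (by rw [Finset.insert_eq_of_mem (by simp)]; exact Finset.card_le_two.trans (by omega))

/-- An edge `e` of `X` is `p`-cocartesian if, for every `n ≥ 2`, every lifting problem of
`Λⁿ₀ ⊆ Δⁿ` against `p` in which the edge `{0, 1}` is sent to `e` has a solution. -/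
def IsCocartesianEdge {X S : SSet.{u}} (p : X ⟶ S) (e : X _⦋1⦌) : Prop :=
  ∀ (n : ℕ) (a : (Λ[n + 2, 0] : SSet.{u}) ⟶ X) (b : Δ[n + 2] ⟶ S),
    a ≫ p = Λ[n + 2, 0].ι ≫ b → a.app _ (firstEdge n) = e →
      ∃ l : Δ[n + 2] ⟶ X, Λ[n + 2, 0].ι ≫ l = a ∧ l ≫ p = b

/-- An edge `e` of `X` is `p`-cartesian if, for every `n ≥ 2`, every lifting problem of
`Λⁿₙ ⊆ Δⁿ` against `p` in which the edge `{n - 1, n}` is sent to `e` has a solution. -/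
def IsCartesianEdge {X S : SSet.{u}} (p : X ⟶ S) (e : X _⦋1⦌) : Prop :=
  ∀ (n : ℕ) (a : (Λ[n + 2, Fin.last (n + 2)] : SSet.{u}) ⟶ X) (b : Δ[n + 2] ⟶ S),
    a ≫ p = Λ[n + 2, Fin.last (n + 2)].ι ≫ b → a.app _ (lastEdge n) = e →
      ∃ l : Δ[n + 2] ⟶ X, Λ[n + 2, Fin.last (n + 2)].ι ≫ l = a ∧ l ≫ p = b

/-- A cartesian fibration is an inner fibration `p : X ⟶ S` such that every edge `f` of `S`
has a `p`-cartesian lift with any prescribed target over the target of `f`. -/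
structure IsCartesianFibration {X S : SSet.{u}} (p : X ⟶ S) : Prop where
  innerFibration : SSet.InnerFibration p
  exists_lift : ∀ (f : S _⦋1⦌) (y : X _⦋0⦌), p.app _ y = S.δ 0 f →
    ∃ e : X _⦋1⦌, p.app _ e = f ∧ X.δ 0 e = y ∧ IsCartesianEdge p e

/-! ### Simplicial sets over `Δ[1]` -/

/-- The vertex `j` of `Δ[1]`. -/
def vertex (j : Fin 2) : (Δ[1] : SSet.{u}) _⦋0⦌ := SSet.stdSimplex.obj₀Equiv.symm j

/-- The fibre of `s : K ⟶ Δ[1]` over the vertex `j`, as a simplicial subset of `K`. -/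
def fiber {K : SSet.{u}} (s : K ⟶ Δ[1]) (j : Fin 2) : K.Subcomplex :=
  (SSet.Subcomplex.ofSimplex (vertex j)).preimage s

/-- The map induced on fibres over `j` by a map `i` of simplicial sets over `Δ[1]`. -/
def fiberMap {K' K : SSet.{u}} (i : K' ⟶ K) (s : K ⟶ Δ[1]) (j : Fin 2) :
    (fiber (i ≫ s) j : SSet.{u}) ⟶ (fiber s j : SSet.{u}) :=
  (fiber s j).fromPreimage i

/-- The image of the edge `{k} × Δ¹` under a map `A : K × Δ¹ ⟶ M`. -/
noncomputable def cylinderEdge {K M : SSet.{u}} (A : K ⊗ Δ[1] ⟶ M) (k : K _⦋0⦌) : M _⦋1⦌ :=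
  SSet.yonedaEquiv (CartesianMonoidalCategory.lift (SSet.const k) (𝟙 Δ[1]) ≫ A)

/-! ### Classification of a functor, partial left adjoints, adjunct data -/

/-- The data through which `p : M ⟶ Δ[1]` (a cartesian fibration) classifies `g : D ⟶ C`:
identifications of `C` and `D` with the fibres over `0` and `1`, and a map `v : D × Δ¹ ⟶ M` over
`Δ¹` which restricts to `g` over `0` and to the identity over `1`, and all of whose edges
`v({d} × Δ¹)` are `p`-cartesian. -/
structure ClassifyingData {C D M : SSet.{u}} (p : M ⟶ Δ[1]) (g : D ⟶ C) where
  h₀ : C ≅ (fiber p 0 : SSet.{u})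
  h₁ : D ≅ (fiber p 1 : SSet.{u})
  v : D ⊗ Δ[1] ⟶ M
  v_comp : v ≫ p = CartesianMonoidalCategory.snd D Δ[1]
  v_zero : SSet.ι₀ ≫ v = g ≫ h₀.hom ≫ (fiber p 0).ι
  v_one : SSet.ι₁ ≫ v = h₁.hom ≫ (fiber p 1).ι
  v_cartesian : ∀ d : D _⦋0⦌, IsCartesianEdge p (cylinderEdge v d)

namespace ClassifyingData

variable {C D M : SSet.{u}} {p : M ⟶ Δ[1]} {g : D ⟶ C}

/-- The inclusion of `C` in `M` as the fibre over `0`. -/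
def inl (H : ClassifyingData p g) : C ⟶ M := H.h₀.hom ≫ (fiber p 0).ι

/-- The inclusion of `D` in `M` as the fibre over `1`. -/
def inr (H : ClassifyingData p g) : D ⟶ M := H.h₁.hom ≫ (fiber p 1).ι

/-- `g` admits a left adjoint at the vertex `c` of `C`: there is a `p`-cocartesian edge of `M` over
the edge `0 ⟶ 1` of `Δ[1]` whose source is `c`. -/
def AdmitsLeftAdjointAt (H : ClassifyingData p g) (c : C _⦋0⦌) : Prop :=
  ∃ e : M _⦋1⦌, p.app _ e = SSet.yonedaEquiv (𝟙 Δ[1]) ∧ M.δ 1 e = H.inl.app _ c ∧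
    IsCocartesianEdge p e

/-- `α : K ⟶ C` and `β : K ⟶ D` are adjunct relative to `s : K ⟶ Δ[1]`. -/
def IsAdjunct (H : ClassifyingData p g) {K : SSet.{u}} (s : K ⟶ Δ[1])
    (α : K ⟶ C) (β : K ⟶ D) : Prop :=
  ∃ A : K ⊗ Δ[1] ⟶ M,
    A ≫ p = CartesianMonoidalCategory.snd K Δ[1] ∧
    SSet.ι₀ ≫ A = α ≫ H.inl ∧
    SSet.ι₁ ≫ A = β ≫ H.inr ∧
    (∀ k ∈ (fiber s 0).obj (op ⦋0⦌), IsCocartesianEdge p (cylinderEdge A k)) ∧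
    (fiber s 1).ι ▷ Δ[1] ≫ A = ((fiber s 1).ι ≫ β) ▷ Δ[1] ≫ H.v

end ClassifyingData

/-! ### Equivalence of functors -/

/-- A map `f : K ⟶ D` as a vertex of the simplicial set `Fun(K, D)`. -/
noncomputable def funVertex {K D : SSet.{u}} (f : K ⟶ D) : ((ihom K).obj D) _⦋0⦌ :=
  SSet.unitHomEquiv _ (MonoidalClosed.curry' f)

/-- Two maps `K ⟶ D` are equivalent as functors if, in `Fun(K, D)`, there is an edge between them
which is invertible up to homotopy. -/
def FunEquivalent {K D : SSet.{u}} (f₁ f₂ : K ⟶ D) : Prop :=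
  ∃ e : SSet.Edge (funVertex f₁) (funVertex f₂), Nonempty e.InvStruct

end AdjunctData

namespace AdjunctData

/-! ### Maps defined by relations, and gluing -/

open SSet

/-! Existence is an extension problem. The map `A'` on `K' × Δ¹` and the map `α` on `K × {0}` glue,
and the result must be extended over `K × Δ¹` relative to `Δ¹`, with cocartesian edges over the
vertices of `K₀`. Restricting the extension to `K × {1}` gives the adjunct. Since `K₁` lies in the
image of `K'`, every missing simplex starts at a vertex of `K₀`. Simplices are attached in order of
dimension, organised by Zorn's lemma (`PartialLift.exists_extension`). A missing vertex receives a
cocartesian edge, supplied by the partial left adjoint. For a missing `n`-simplex with `n > 0` the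
prism `Δⁿ × Δ¹` is filled by `n` inner horns and one horn `Λⁿ⁺¹₀` whose first edge is cocartesian
(`exists_prism_extension_succ`).

Uniqueness is existence applied to `K × J`, where `J` is the coherent isomorphism, relative to `K₁ ×
J ∪ K × {x₀, x₁}`. Two adjuncts define the lift there, and the extension is a map `K × J ⟶ D`
joining them, i.e. an invertible edge of `Fun(K, D)`. -/

lemma hom_ext_apply {X Y : SSet.{u}} {f g : X ⟶ Y} (h : ∀ n (x : X.obj n), f.app n x = g.app n x) :
    f = g := by
  apply NatTrans.ext
  funext n
  ext x
  exact h n x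

lemma congr_app_apply {X Y : SSet.{u}} {f g : X ⟶ Y} (h : f = g) (n) (x : X.obj n) :
    f.app n x = g.app n x := by
  rw [h]

/-- A total, functional and natural relation between simplices is a map of simplicial sets. -/
lemma exists_hom_of_rel {X M : SSet.{u}} (R : ∀ n, X.obj n → M.obj n → Prop)
    (htot : ∀ n x, ∃ m, R n x m) (hfun : ∀ n x m m', R n x m → R n x m' → m = m')
    (hnat : ∀ n n' (φ : n ⟶ n') x m, R n x m → R n' (X.map φ x) (M.map φ m)) :
    ∃ f : X ⟶ M, ∀ n x, R n x (f.app n x) := by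
  choose F hF using htot
  refine ⟨{ app n := ↾(F n), naturality n n' φ := ?_ }, hF⟩
  ext x
  exact hfun _ _ _ _ (hF _ _) (hnat _ _ _ _ _ (hF _ _))

/-- A map on a subcomplex `Z` and a map on `T` which agree where they meet glue to a map on any
subcomplex covered by `Z` and the image of `T`, if `T` is embedded outside `Z`. -/
lemma exists_glue {Y M T : SSet.{u}} {Z Z' : Y.Subcomplex} (h : Z ≤ Z') (τ : T ⟶ Y)
    (f : (Z : SSet.{u}) ⟶ M) (l : T ⟶ M)
    (hcov : ∀ n (y : Y.obj n), y ∈ Z'.obj n → y ∈ Z.obj n ∨ ∃ t, τ.app n t = y)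
    (hinj : ∀ n (t t' : T.obj n), τ.app n t ∉ Z.obj n → τ.app n t = τ.app n t' → t = t')
    (hagree : ∀ n t (ht : τ.app n t ∈ Z.obj n), l.app n t = f.app n ⟨_, ht⟩) :
    ∃ f' : (Z' : SSet.{u}) ⟶ M, (∀ n (z : Y.obj n) (hz : z ∈ Z.obj n),
      f'.app n ⟨z, h _ hz⟩ = f.app n ⟨z, hz⟩) ∧
      ∀ n t (ht : τ.app n t ∈ Z'.obj n), f'.app n ⟨_, ht⟩ = l.app n t := by
  obtain ⟨f', hf'⟩ := exists_hom_of_rel (X := (Z' : SSet.{u})) (M := M)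
    (fun n y m => (∃ hy : y.1 ∈ Z.obj n, f.app n ⟨_, hy⟩ = m) ∨ ∃ t, τ.app n t = y.1 ∧ l.app n t = m)
    (fun n y => by
      rcases hcov n y.1 y.2 with hy | ⟨t, ht⟩
      · exact ⟨_, Or.inl ⟨hy, rfl⟩⟩
      · exact ⟨_, Or.inr ⟨t, ht, rfl⟩⟩)
    (by
      rintro n ⟨y, hy'⟩ m m' (⟨hy, rfl⟩ | ⟨t, rfl, rfl⟩) (⟨hy₁, rfl⟩ | ⟨t', ht', rfl⟩)
      · rfl
      · subst ht'
        exact (hagree _ _ _).symm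
      · exact hagree _ _ _
      · by_cases ht : τ.app n t ∈ Z.obj n
        · have ht₂ : τ.app n t' ∈ Z.obj n := by rw [ht']; exact ht
          rw [hagree _ _ ht, hagree _ _ ht₂]
          exact congrArg (f.app n) (Subtype.ext ht'.symm)
        · rw [hinj n t t' ht ht'.symm])
    (by
      rintro n n' φ ⟨y, hy'⟩ m (⟨hy, rfl⟩ | ⟨t, rfl, rfl⟩)
      · exact Or.inl ⟨Z.map φ hy, (NatTrans.naturality_apply f φ ⟨y, hy⟩)⟩
      · exact Or.inr ⟨T.map φ t, NatTrans.naturality_apply τ φ t, NatTrans.naturality_apply l φ t⟩)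
  refine ⟨f', fun n z hz => ?_, fun n t ht => ?_⟩
  · rcases hf' n ⟨z, h _ hz⟩ with ⟨_, h₁⟩ | ⟨t, rfl, h₁⟩
    · exact h₁.symm
    · exact h₁.symm.trans (hagree _ _ _)
  · rcases hf' n ⟨_, ht⟩ with ⟨h₂, h₁⟩ | ⟨t', h₂, h₁⟩
    · exact h₁.symm.trans (hagree _ _ _).symm
    · by_cases ht : τ.app n t ∈ Z.obj n
      · have ht₂ : τ.app n t' ∈ Z.obj n := by rw [h₂]; exact ht
        rw [← h₁, hagree _ _ ht, hagree _ _ ht₂]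
        exact congrArg (f.app n) (Subtype.ext h₂)
      · rw [← h₁, hinj n t t' ht h₂.symm]

/-! ### The prism -/

/-- The filtration of the prism `Δⁿ × Δ¹` from `∂Δⁿ × Δ¹ ∪ Δⁿ × {0}` (for `k = n + 1`) to the whole
prism (for `k = 0`). -/
def prismStage (n k : ℕ) : (Δ[n] ⊗ Δ[1] : SSet.{u}).Subcomplex where
  obj m := Set.ofPred (fun z : Δ[n].obj m × Δ[1].obj m =>
    ¬ Function.Surjective (stdSimplex.asOrderHom z.1) ∨
      ∀ i, stdSimplex.asOrderHom z.2 i = 1 → k ≤ (stdSimplex.asOrderHom z.1 i).val)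
  map φ z := by
    rintro (h | h)
    · exact Or.inl fun hs => h (Function.Surjective.of_comp hs)
    · exact Or.inr fun i hi => h _ hi

lemma mem_prismStage_iff {n k : ℕ} {m} (z : (Δ[n] ⊗ Δ[1] : SSet.{u}).obj m) :
    z ∈ (prismStage n k).obj m ↔ ¬ Function.Surjective (stdSimplex.asOrderHom z.1) ∨
      ∀ i, stdSimplex.asOrderHom z.2 i = 1 → k ≤ (stdSimplex.asOrderHom z.1 i).val := Iff.rfl

lemma prismStage_anti {n k k' : ℕ} (h : k ≤ k') :
    prismStage.{u} n k' ≤ prismStage n k := by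
  rintro m z (hz | hz)
  · exact Or.inl hz
  · exact Or.inr fun i hi => h.trans (hz i hi)

lemma prismStage_zero (n : ℕ) : prismStage.{u} n 0 = ⊤ := by
  ext m z
  exact iff_of_true (Or.inr fun _ _ => Nat.zero_le _) trivial

/-- The `(n + 1)`-simplex `(0,0), …, (k,0), (k,1), …, (n,1)` of the prism `Δⁿ × Δ¹`. -/
noncomputable def prismSimplex (n : ℕ) (k : Fin (n + 1)) : (Δ[n + 1] : SSet.{u}) ⟶ Δ[n] ⊗ Δ[1] :=
  CartesianMonoidalCategory.lift (SSet.stdSimplex.map (SimplexCategory.σ k))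
    (yonedaEquiv.symm (stdSimplex.objMk₁ k.succ.castSucc))

lemma prismSimplex_fst {n : ℕ} (k : Fin (n + 1)) {m} (t : (Δ[n + 1] : SSet.{u}).obj m) (i) :
    stdSimplex.asOrderHom ((prismSimplex n k).app m t).1 i =
      k.predAbove (stdSimplex.asOrderHom t i) := rfl

lemma prismSimplex_snd {n : ℕ} (k : Fin (n + 1)) {m} (t : (Δ[n + 1] : SSet.{u}).obj m) (i) :
    stdSimplex.asOrderHom ((prismSimplex n k).app m t).2 i =
      if (stdSimplex.asOrderHom t i).val ≤ k.val then 0 else 1 := by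
  have : stdSimplex.asOrderHom ((prismSimplex n k).app m t).2 i =
      if (stdSimplex.asOrderHom t i).castSucc < k.succ.castSucc then 0 else 1 := rfl
  rw [this]
  simp only [Fin.lt_def, Fin.val_castSucc, Fin.val_succ, Nat.lt_succ_iff]

lemma asOrderHom_injective {n : ℕ} {m} :
    Function.Injective (stdSimplex.asOrderHom : (Δ[n] : SSet.{u}).obj m → _) := by
  intro x y h
  apply stdSimplex.objEquiv.injective
  ext i
  exact congrArg Fin.val (DFunLike.congr_fun h i)

lemma prismSimplex_injective {n : ℕ} (k : Fin (n + 1)) {m} :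
    Function.Injective ((prismSimplex.{u} n k).app m) := by
  intro t t' h
  apply asOrderHom_injective
  ext i
  have h₁ := congrArg (fun z => (stdSimplex.asOrderHom z.1 i).val) h
  have h₂ := congrArg (fun z => stdSimplex.asOrderHom z.2 i) h
  simp only [prismSimplex_fst, prismSimplex_snd, Fin.predAbove, Fin.lt_def, Fin.val_castSucc] at h₁ h₂
  split_ifs at h₁ h₂ <;> simp at h₁ h₂ <;> omega

/-- The facets opposite `j ≠ k, k + 1` project to proper faces of `Δⁿ`. The facet opposite `k + 1`
omits the vertex `(k, 1)`, so it lies in stage `k + 1`. Only the facet opposite `k` is new, which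
leaves the horn at `k`. -/
lemma prismSimplex_mem_iff {n : ℕ} (k : Fin (n + 1)) {m} (t : (Δ[n + 1] : SSet.{u}).obj m) :
    (prismSimplex n k).app m t ∈ (prismStage n (k.val + 1)).obj m ↔
      t ∈ Λ[n + 1, k.castSucc].obj m := by
  rw [mem_prismStage_iff, mem_horn_iff, Set.ne_univ_iff_exists_notMem]
  simp only [Set.mem_union, Set.mem_range, Set.mem_singleton_iff, not_or, not_exists]
  constructor
  · rintro (h | h)
    · simp only [Function.Surjective, not_forall, not_exists] at h
      obtain ⟨j, hj⟩ := h
      simp only [prismSimplex_fst] at hj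
      by_cases hjk : j ≤ k
      · by_cases hjk' : j = k
        · refine ⟨k.succ, fun i hi => hj i ?_, ?_⟩
          · rw [hi, hjk']; simp
          · simp [Fin.ext_iff]
        · refine ⟨j.castSucc, fun i hi => hj i ?_, ?_⟩
          · rw [hi]; exact Fin.predAbove_castSucc_of_le _ _ hjk
          · simpa [Fin.ext_iff] using hjk'
      · refine ⟨j.succ, fun i hi => hj i ?_, ?_⟩
        · rw [hi]; exact Fin.predAbove_succ_of_le _ _ (le_of_not_ge hjk)
        · have := not_le.1 hjk
          rw [Fin.lt_def] at this
          rw [Fin.ext_iff, Fin.val_succ, Fin.val_castSucc]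
          omega
    · refine ⟨k.succ, fun i hi => ?_, by simp [Fin.ext_iff]⟩
      have := h i
      rw [prismSimplex_fst, prismSimplex_snd, hi] at this
      simp at this
  · rintro ⟨j, hj, hjk⟩
    by_cases hj' : j = k.succ
    · right
      intro i hi
      rw [prismSimplex_snd] at hi
      rw [prismSimplex_fst]
      have h₁ := hj i
      subst hj'
      rw [Fin.ext_iff] at h₁
      split_ifs at hi with h₂
      · simp at hi
      · rw [Fin.predAbove_of_castSucc_lt _ _ (by simp [Fin.lt_def]; omega)]
        simp at h₁ ⊢
        omega
    · left
      intro hs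
      rw [Fin.ext_iff] at hj' hjk
      simp only [Fin.val_succ, Fin.val_castSucc] at hj' hjk
      obtain ⟨i, hi⟩ := hs (k.predAbove j)
      rw [prismSimplex_fst] at hi
      apply hj i
      have hi := congrArg Fin.val hi
      apply Fin.ext
      simp only [Fin.predAbove, Fin.lt_def, Fin.val_castSucc] at hi
      split_ifs at hi <;> simp at hi <;> omega

/-- A new simplex is surjective onto `Δⁿ` and has `(k, 1)` among its vertices. By monotonicity its
first coordinate is at most `k` where the second is `0`, and at least `k` where it is `1`, so it
factors through the `k`-th prism simplex. -/
lemma mem_prismStage_cases {n : ℕ} (k : Fin (n + 1)) {m} (z : (Δ[n] ⊗ Δ[1] : SSet.{u}).obj m)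
    (hz : z ∈ (prismStage n k.val).obj m) :
    z ∈ (prismStage n (k.val + 1)).obj m ∨ ∃ t, (prismSimplex n k).app m t = z := by
  by_cases hz' : z ∈ (prismStage n (k.val + 1)).obj m
  · exact Or.inl hz'
  right
  rw [mem_prismStage_iff] at hz hz'
  push Not at hz'
  obtain ⟨hs, i₀, hi₀, hlt⟩ := hz'
  have hk := hz.resolve_left (not_not.2 hs)
  have h₀ : ∀ i, stdSimplex.asOrderHom z.2 i = 0 → (stdSimplex.asOrderHom z.1 i).val ≤ k.val := by
    intro i hi
    rcases le_total i i₀ with h | h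
    · have := (stdSimplex.asOrderHom z.1).monotone h
      rw [Fin.le_def] at this
      omega
    · have := (stdSimplex.asOrderHom z.2).monotone h
      rw [hi, hi₀] at this
      simp at this
  have h01 : ∀ i, stdSimplex.asOrderHom z.2 i = 0 ∨ stdSimplex.asOrderHom z.2 i = 1 := by
    intro i
    generalize stdSimplex.asOrderHom z.2 i = a
    fin_cases a <;> simp
  -- In the prism simplex, `(a, 0)` is vertex number `a` and `(a, 1)` is vertex number `a + 1`.
  let g : Fin (m.unop.len + 1) →o Fin (n + 2) :=
    { toFun i := if stdSimplex.asOrderHom z.2 i = 0 then (stdSimplex.asOrderHom z.1 i).castSucc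
        else (stdSimplex.asOrderHom z.1 i).succ
      monotone' i j hij := by
        have h₁ := (stdSimplex.asOrderHom z.1).monotone hij
        have h₂ := (stdSimplex.asOrderHom z.2).monotone hij
        dsimp only
        rw [Fin.le_def] at h₁
        split_ifs with h₃ h₄ h₄
        · rwa [Fin.le_def, Fin.val_castSucc, Fin.val_castSucc]
        · rw [Fin.le_def, Fin.val_castSucc, Fin.val_succ]; omega
        · rw [h₄] at h₂
          exact absurd (le_antisymm h₂ (Fin.zero_le _)) h₃
        · rw [Fin.le_def, Fin.val_succ, Fin.val_succ]; omega }
  have hg₀ : ∀ i, stdSimplex.asOrderHom z.2 i = 0 → stdSimplex.asOrderHom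
      (stdSimplex.objMk g : (Δ[n + 1] : SSet.{u}).obj m) i =
        (stdSimplex.asOrderHom z.1 i).castSucc := fun i h => if_pos h
  have hg₁ : ∀ i, stdSimplex.asOrderHom z.2 i = 1 → stdSimplex.asOrderHom
      (stdSimplex.objMk g : (Δ[n + 1] : SSet.{u}).obj m) i =
        (stdSimplex.asOrderHom z.1 i).succ := fun i h => if_neg (by rw [h]; decide)
  refine ⟨stdSimplex.objMk g, Prod.ext (asOrderHom_injective ?_) (asOrderHom_injective ?_)⟩
  · ext i : 2
    rw [prismSimplex_fst]
    rcases h01 i with h | h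
    · rw [hg₀ i h, Fin.predAbove_castSucc_of_le _ _ (h₀ i h)]
    · rw [hg₁ i h, Fin.predAbove_succ_of_le _ _ (hk i h)]
  · ext i : 2
    rw [prismSimplex_snd]
    rcases h01 i with h | h
    · rw [hg₀ i h, h]
      exact if_pos (h₀ i h)
    · have := hk i h
      rw [hg₁ i h, h, if_neg (by rw [Fin.val_succ]; omega)]

lemma exists_prism_step {M : SSet.{u}} (p : M ⟶ Δ[1]) {n : ℕ} (k : Fin (n + 1))
    (f : (prismStage n (k.val + 1) : SSet.{u}) ⟶ M)
    (hf : f ≫ p = (prismStage n (k.val + 1)).ι ≫ CartesianMonoidalCategory.snd _ _)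
    (l : Δ[n + 1] ⟶ M) (hlp : l ≫ p = prismSimplex n k ≫ CartesianMonoidalCategory.snd _ _)
    (hl : ∀ m t (ht : (prismSimplex n k).app m t ∈ (prismStage n (k.val + 1)).obj m),
      l.app m t = f.app m ⟨_, ht⟩) :
    ∃ f' : (prismStage n k.val : SSet.{u}) ⟶ M,
      f' ≫ p = (prismStage n k.val).ι ≫ CartesianMonoidalCategory.snd _ _ ∧
      (∀ m z (hz : z ∈ (prismStage n (k.val + 1)).obj m),
        f'.app m ⟨z, prismStage_anti (Nat.le_succ _) _ hz⟩ = f.app m ⟨z, hz⟩) ∧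
      ∀ m t (ht : (prismSimplex n k).app m t ∈ (prismStage n k.val).obj m),
        f'.app m ⟨_, ht⟩ = l.app m t := by
  obtain ⟨f', h₁, h₂⟩ := exists_glue (prismStage_anti (Nat.le_succ k.val)) (prismSimplex n k) f l
    (fun m z hz => mem_prismStage_cases k z hz)
    (fun m t t' _ h => prismSimplex_injective k h) hl
  refine ⟨f', ?_, h₁, h₂⟩
  refine hom_ext_apply fun m ⟨z, hz⟩ => ?_
  rcases mem_prismStage_cases k z hz with hz' | ⟨t, rfl⟩
  · exact (congrArg (p.app m) (h₁ m z hz')).trans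
      (congr_app_apply hf m ⟨z, hz'⟩)
  · exact (congrArg (p.app m) (h₂ m t hz)).trans
      (congr_app_apply hlp m t)

/-- The horn of a prism simplex which lies in the previous stage of the filtration. -/
noncomputable def prismHorn {n : ℕ} (k : Fin (n + 1)) :
    (Λ[n + 1, k.castSucc] : SSet.{u}) ⟶ (prismStage n (k.val + 1) : SSet.{u}) :=
  Subcomplex.lift (Λ[n + 1, k.castSucc].ι ≫ prismSimplex n k) (by
    rintro m _ ⟨t, rfl⟩
    exact (prismSimplex_mem_iff k t.1).2 t.2)

/-- The edge `{0} × Δ¹` of the prism `Δⁿ × Δ¹`. -/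
def prismEdge (n : ℕ) : (Δ[n] ⊗ Δ[1] : SSet.{u}) _⦋1⦌ :=
  (stdSimplex.const n 0 _, yonedaEquiv (𝟙 Δ[1]))

/-- The vertex `(0, 0)` of the prism `Δⁿ × Δ¹`. -/
def prismVertex (n : ℕ) : (Δ[n] ⊗ Δ[1] : SSet.{u}) _⦋0⦌ :=
  (stdSimplex.const n 0 _, vertex 0)

lemma prismVertex_mem (n k : ℕ) : prismVertex.{u} n ∈ (prismStage n k).obj _ :=
  Or.inr fun i (hi : (0 : Fin 2) = 1) => absurd hi (by decide)

/-- In positive dimension the edge lies over a single vertex, hence over the boundary, so its image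
is prescribed from the start. -/
lemma prismEdge_mem (n k : ℕ) : prismEdge.{u} (n + 1) ∈ (prismStage (n + 1) k).obj _ := by
  left
  intro hs
  obtain ⟨i, hi⟩ := hs 1
  exact absurd (show (0 : Fin (n + 2)) = 1 from hi) (by simp)

lemma prismSimplex_zero_edge (n : ℕ) :
    (prismSimplex.{u} (n + 1) 0).app _ (firstEdge n).1 = prismEdge (n + 1) := by
  refine Prod.ext (asOrderHom_injective ?_) (asOrderHom_injective ?_)
  · ext i : 2
    rw [prismSimplex_fst]
    have h : stdSimplex.asOrderHom (firstEdge.{u} n).1 i = ![0, 1] i := rfl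
    rw [h]
    fin_cases i <;> rfl
  · ext i : 2
    rw [prismSimplex_snd]
    have h : stdSimplex.asOrderHom (firstEdge.{u} n).1 i = ![0, 1] i := rfl
    rw [h]
    fin_cases i <;> rfl

lemma exists_prism_step_of_lift {M : SSet.{u}} (p : M ⟶ Δ[1]) {n : ℕ} (k : Fin (n + 1))
    (f : (prismStage n (k.val + 1) : SSet.{u}) ⟶ M)
    (hf : f ≫ p = (prismStage n (k.val + 1)).ι ≫ CartesianMonoidalCategory.snd _ _)
    (hl : ∃ l : Δ[n + 1] ⟶ M, Λ[n + 1, k.castSucc].ι ≫ l = prismHorn k ≫ f ∧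
      l ≫ p = prismSimplex n k ≫ CartesianMonoidalCategory.snd _ _) :
    ∃ f' : (prismStage n k.val : SSet.{u}) ⟶ M,
      f' ≫ p = (prismStage n k.val).ι ≫ CartesianMonoidalCategory.snd _ _ ∧
      ∀ m z (hz : z ∈ (prismStage n (k.val + 1)).obj m),
        f'.app m ⟨z, prismStage_anti (Nat.le_succ _) _ hz⟩ = f.app m ⟨z, hz⟩ := by
  obtain ⟨l, hl, hlp⟩ := hl
  obtain ⟨f', h₁, h₂, -⟩ := exists_prism_step p k f hf l hlp fun m t ht =>
    congr_app_apply hl m ⟨t, (prismSimplex_mem_iff k t).1 ht⟩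
  exact ⟨f', h₁, h₂⟩

lemma prismHorn_comp {M : SSet.{u}} {p : M ⟶ Δ[1]} {n : ℕ} {k : Fin (n + 1)}
    {f : (prismStage n (k.val + 1) : SSet.{u}) ⟶ M}
    (hf : f ≫ p = (prismStage n (k.val + 1)).ι ≫ CartesianMonoidalCategory.snd _ _) :
    (prismHorn k ≫ f) ≫ p = Λ[n + 1, k.castSucc].ι ≫ prismSimplex n k ≫
      CartesianMonoidalCategory.snd _ _ := by
  rw [Category.assoc, hf]
  rfl

/-- The prism simplices are attached for `k = n + 1, …, 0`. The horn at `k` in `Δ[n + 2]` is inner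
for `k > 0`. For `k = 0` its first edge is `{0} × Δ¹`, assumed to be sent to a cocartesian edge. -/
lemma exists_prism_extension_succ {M : SSet.{u}} (p : M ⟶ Δ[1]) [InnerFibration p] (n : ℕ)
    (f : (prismStage (n + 1) (n + 2) : SSet.{u}) ⟶ M)
    (hf : f ≫ p = (prismStage (n + 1) (n + 2)).ι ≫ CartesianMonoidalCategory.snd _ _)
    (he : IsCocartesianEdge p (f.app _ ⟨prismEdge (n + 1), prismEdge_mem _ _⟩)) :
    ∃ F : Δ[n + 1] ⊗ Δ[1] ⟶ M, F ≫ p = CartesianMonoidalCategory.snd _ _ ∧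
      ∀ m z (hz : z ∈ (prismStage (n + 1) (n + 2)).obj m), F.app m z = f.app m ⟨z, hz⟩ := by
  -- Here `d` counts the prism simplices already attached, starting from stage `n + 2`.
  have key : ∀ d k (hk : k + d = n + 2), ∃ f' : (prismStage (n + 1) k : SSet.{u}) ⟶ M,
      f' ≫ p = (prismStage (n + 1) k).ι ≫ CartesianMonoidalCategory.snd _ _ ∧
      ∀ m z (hz : z ∈ (prismStage (n + 1) (n + 2)).obj m),
        f'.app m ⟨z, prismStage_anti (by omega) _ hz⟩ = f.app m ⟨z, hz⟩ := by
    intro d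
    induction d with
    | zero =>
      intro k hk
      obtain rfl : k = n + 2 := hk
      exact ⟨f, hf, fun m z hz => rfl⟩
    | succ d ih =>
      intro k hk
      obtain ⟨f₁, hf₁, h₁⟩ := ih (k + 1) (by omega)
      rcases Nat.eq_zero_or_pos k with rfl | hk'
      · obtain ⟨l, hl, hlp⟩ := he n (prismHorn (0 : Fin (n + 2)) ≫ f₁)
          (prismSimplex (n + 1) 0 ≫ CartesianMonoidalCategory.snd _ _)
          (prismHorn_comp (k := (0 : Fin (n + 2))) hf₁) (by
            rw [← h₁]
            exact congrArg (f₁.app _) (Subtype.ext (prismSimplex_zero_edge n)))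
        obtain ⟨f', h₂, h₃⟩ := exists_prism_step_of_lift p (0 : Fin (n + 2)) f₁ hf₁ ⟨l, hl, hlp⟩
        exact ⟨f', h₂, fun m z hz => (h₃ m z _).trans (h₁ m z hz)⟩
      · let j : Fin (n + 2) := ⟨k, by omega⟩
        have := InnerFibration.mem (q := p) _ (horn_ι_mem_innerHornInclusions (i := j.castSucc)
          (by rw [Fin.lt_def]; exact hk') (Fin.castSucc_lt_last _))
        have sq : CommSq (prismHorn j ≫ f₁) Λ[n + 2, j.castSucc].ι p
            (prismSimplex (n + 1) j ≫ CartesianMonoidalCategory.snd _ _) :=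
          ⟨prismHorn_comp (k := j) hf₁⟩
        obtain ⟨f', h₂, h₃⟩ := exists_prism_step_of_lift p j f₁ hf₁
          ⟨sq.lift, sq.fac_left, sq.fac_right⟩
        exact ⟨f', h₂, fun m z hz => (h₃ m z _).trans (h₁ m z hz)⟩
  obtain ⟨f', h₁, h₂⟩ := key (n + 2) 0 (by omega)
  have hr : Subcomplex.range (𝟙 (Δ[n + 1] ⊗ Δ[1] : SSet.{u})) ≤ prismStage (n + 1) 0 := by
    rw [prismStage_zero]; exact le_top
  exact ⟨Subcomplex.lift (𝟙 _) hr ≫ f', by rw [Category.assoc, h₁]; rfl, fun m z hz => h₂ m z hz⟩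

/-- Over a point the prism is one edge with prescribed source. The lifting property of cocartesian
edges begins in dimension 2, so the edge itself must be supplied. -/
lemma exists_prism_extension_zero {M : SSet.{u}} (p : M ⟶ Δ[1])
    (f : (prismStage 0 1 : SSet.{u}) ⟶ M) (e : M _⦋1⦌) (he : p.app _ e = yonedaEquiv (𝟙 Δ[1]))
    (hef : M.δ 1 e = f.app _ ⟨prismVertex 0, prismVertex_mem _ _⟩)
    (hf : f ≫ p = (prismStage 0 1).ι ≫ CartesianMonoidalCategory.snd _ _) :
    ∃ F : Δ[0] ⊗ Δ[1] ⟶ M, F ≫ p = CartesianMonoidalCategory.snd _ _ ∧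
      (∀ m z (hz : z ∈ (prismStage 0 1).obj m), F.app m z = f.app m ⟨z, hz⟩) ∧
      F.app _ (prismEdge 0) = e := by
  have hp : prismSimplex.{u} 0 0 ≫ CartesianMonoidalCategory.snd _ _ = 𝟙 Δ[1] := by
    have : stdSimplex.objMk₁.{u} (0 : Fin 1).succ.castSucc = yonedaEquiv (𝟙 Δ[1]) := by
      ext i : 1
      fin_cases i <;> rfl
    refine (CartesianMonoidalCategory.lift_snd _ _).trans ?_
    rw [this, Equiv.symm_apply_apply]
  have hl₀ : (yonedaEquiv.symm e).app _ (vertex 0) = M.δ 1 e := by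
    have : vertex.{u} 0 = Δ[1].δ 1 (yonedaEquiv (𝟙 Δ[1])) := by
      ext i : 1
      fin_cases i
      rfl
    rw [this]
    exact (SSet.δ_naturality_apply (yonedaEquiv.symm e) _ _).trans
      (congrArg (M.δ 1) (yonedaEquiv_symm_app_id e))
  obtain ⟨f', h₁, h₂, h₃⟩ := exists_prism_step p (0 : Fin 1) f hf (yonedaEquiv.symm e)
    (by rw [yonedaEquiv_symm_comp, he, Equiv.symm_apply_apply]; exact hp.symm) (by
      intro m t ht
      -- The horn `Λ[1, 0]` is the vertex `0`, so agreement need only be checked on its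
      -- degeneracies.
      have ht' : t = Δ[1].map (m.unop.const _ 0).op (vertex 0) := by
        apply asOrderHom_injective
        ext i : 2
        obtain ⟨j, hj⟩ := (Set.ne_univ_iff_exists_notMem _).1 ((prismSimplex_mem_iff 0 t).1 ht)
        simp only [Set.mem_union, Set.mem_range, not_or, not_exists, Set.mem_singleton_iff] at hj
        have aux : ∀ a j : Fin 2, ¬ a = j → ¬ j = 0 → a = 0 := by decide
        exact aux _ j (hj.1 i) hj.2
      subst ht'
      refine (NatTrans.naturality_apply (yonedaEquiv.symm e) _ _).trans ?_
      rw [hl₀, hef]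
      refine (NatTrans.naturality_apply f _ _).symm.trans (congrArg _ (Subtype.ext ?_))
      refine Prod.ext ?_ (congr_app_apply hp m _).symm
      apply asOrderHom_injective
      ext i : 2
      exact Subsingleton.elim (α := Fin 1) _ _)
  have hr : Subcomplex.range (𝟙 (Δ[0] ⊗ Δ[1] : SSet.{u})) ≤ prismStage 0 0 := by
    rw [prismStage_zero]; exact le_top
  refine ⟨Subcomplex.lift (𝟙 _) hr ≫ f', by rw [Category.assoc]; erw [h₁]; rfl,
    fun m z hz => h₂ m z hz, ?_⟩
  have hE : prismEdge.{u} 0 = (prismSimplex 0 0).app _ (yonedaEquiv (𝟙 Δ[1])) := by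
    refine Prod.ext ?_ (congr_app_apply hp _ _).symm
    apply asOrderHom_injective
    ext i : 2
    exact Subsingleton.elim (α := Fin 1) _ _
  rw [hE]
  exact (h₃ _ _ (by erw [prismStage_zero]; trivial)).trans (yonedaEquiv_symm_app_id e)

/-! ### Extension along cylinders -/

section

variable {K M : SSet.{u}}

/-- The subcomplex `L × Δ¹ ∪ K × {0}` of the cylinder `K × Δ¹`. -/
def cyl (L : K.Subcomplex) : (K ⊗ Δ[1]).Subcomplex where
  obj m := Set.ofPred (fun z : K.obj m × Δ[1].obj m =>
    z.1 ∈ L.obj m ∨ ∀ i, stdSimplex.asOrderHom z.2 i = 0)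
  map φ z := by
    rintro (h | h)
    · exact Or.inl (L.map φ h)
    · exact Or.inr fun i => h _

lemma cyl_mono {L L' : K.Subcomplex} (h : L ≤ L') : cyl L ≤ cyl L' := by
  rintro m z (hz | hz)
  · exact Or.inl (h _ hz)
  · exact Or.inr hz

/-- The edge `{k} × Δ¹` of the cylinder `K × Δ¹`. -/
def cylEdge (k : K _⦋0⦌) : (K ⊗ Δ[1]) _⦋1⦌ :=
  (K.map (SimplexCategory.const ⦋1⦌ ⦋0⦌ 0).op k, yonedaEquiv (𝟙 Δ[1]))

lemma cylEdge_mem {L : K.Subcomplex} {k : K _⦋0⦌} (hk : k ∈ L.obj _) :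
    cylEdge k ∈ (cyl L).obj _ := Or.inl (L.map _ hk)

/-- The vertex `(k, 0)` of the cylinder `K × Δ¹`. -/
lemma cylVertex_mem (L : K.Subcomplex) (k : K _⦋0⦌) :
    ((k, vertex 0) : (K ⊗ Δ[1] : SSet.{u}) _⦋0⦌) ∈ (cyl L).obj _ := Or.inr fun _ => rfl

/-- A lift to `M`, over `Δ¹`, of `L × Δ¹ ∪ K × {0}` for a subcomplex `L` of `K`, whose edges at
the vertices of `L` in `P` are cocartesian. -/
structure PartialLift (p : M ⟶ Δ[1]) (P : Set (K _⦋0⦌)) where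
  dom : K.Subcomplex
  map : (cyl dom : SSet.{u}) ⟶ M
  map_comp : map ≫ p = (cyl dom).ι ≫ CartesianMonoidalCategory.snd _ _
  cocartesian : ∀ k ∈ P, ∀ hk : k ∈ dom.obj _,
    IsCocartesianEdge p (map.app _ ⟨cylEdge k, cylEdge_mem hk⟩)

namespace PartialLift

variable {p : M ⟶ Δ[1]} {P : Set (K _⦋0⦌)}

instance : Preorder (PartialLift p P) where
  le a b := ∃ h : a.dom ≤ b.dom, ∀ m z (hz : z ∈ (cyl a.dom).obj m),
    b.map.app m ⟨z, cyl_mono h _ hz⟩ = a.map.app m ⟨z, hz⟩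
  le_refl a := ⟨le_rfl, fun _ _ _ => rfl⟩
  le_trans a b c := fun ⟨h₁, h₂⟩ ⟨h₃, h₄⟩ =>
    ⟨h₁.trans h₃, fun m z hz => (h₄ m z _).trans (h₂ m z hz)⟩

lemma exists_upper_bound (c : Set (PartialLift p P)) (hc : IsChain (· ≤ ·) c)
    (hne : c.Nonempty) : ∃ b, ∀ a ∈ c, a ≤ b := by
  let L : K.Subcomplex := ⨆ a : c, a.1.dom
  have hL : ∀ {m} (x : K.obj m), x ∈ L.obj m ↔ ∃ a ∈ c, x ∈ a.dom.obj m := by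
    intro m x
    simp [L]
  have hcyl : ∀ {m} (z : (K ⊗ Δ[1]).obj m), z ∈ (cyl L).obj m → ∃ a ∈ c, z ∈ (cyl a.dom).obj m := by
    rintro m z (hz | hz)
    · obtain ⟨a, ha, h⟩ := (hL _).1 hz
      exact ⟨a, ha, Or.inl h⟩
    -- `K × {0}` belongs to the domain of every member, so any one will do; this uses that the chain
    -- is nonempty.
    · exact ⟨hne.some, hne.some_mem, Or.inr hz⟩
  obtain ⟨f, hf⟩ := exists_hom_of_rel (X := (cyl L : SSet.{u})) (M := M)
    (fun n z m => ∃ a ∈ c, ∃ hz : z.1 ∈ (cyl a.dom).obj n, a.map.app n ⟨_, hz⟩ = m)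
    (fun n z => by
      obtain ⟨a, ha, hz⟩ := hcyl z.1 z.2
      exact ⟨_, a, ha, hz, rfl⟩)
    (by
      rintro n ⟨z, hz⟩ m m' ⟨a, ha, hza, rfl⟩ ⟨b, hb, hzb, rfl⟩
      rcases hc.total ha hb with ⟨_, h⟩ | ⟨_, h⟩
      · exact (h _ _ hza).symm
      · exact h _ _ hzb)
    (by
      rintro n n' φ ⟨z, hz⟩ m ⟨a, ha, hza, rfl⟩
      exact ⟨a, ha, (cyl a.dom).map φ hza, NatTrans.naturality_apply a.map φ ⟨z, hza⟩⟩)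
  have hf' : ∀ a ∈ c, ∀ n z (hz : z ∈ (cyl L).obj n) (hza : z ∈ (cyl a.dom).obj n),
      f.app n ⟨z, hz⟩ = a.map.app n ⟨z, hza⟩ := by
    intro a ha n z hz hza
    obtain ⟨b, hb, hzb, h⟩ := hf n ⟨z, hz⟩
    rw [← h]
    rcases hc.total ha hb with ⟨_, h⟩ | ⟨_, h⟩
    · exact h _ _ hza
    · exact (h _ _ hzb).symm
  refine ⟨⟨L, f, ?_, ?_⟩, fun a ha => ⟨le_iSup (fun a : c => a.1.dom) ⟨a, ha⟩, fun m z hz => ?_⟩⟩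
  · refine hom_ext_apply fun n ⟨z, hz⟩ => ?_
    obtain ⟨a, ha, hza⟩ := hcyl z hz
    exact (congrArg (p.app n) (hf' a ha n z hz hza)).trans (congr_app_apply a.map_comp n ⟨z, hza⟩)
  · intro k hkP hk
    obtain ⟨a, ha, hka⟩ := (hL _).1 hk
    rw [hf' a ha _ _ _ (cylEdge_mem hka)]
    exact a.cocartesian k hkP hka
  · exact hf' a ha _ _ _ hz

/-! ### Attaching one simplex of minimal dimension -/

section Cell

variable (a : PartialLift p P) {n : ℕ} (x : K _⦋n⦌)

/-- Such a `t` factors through a proper face, of dimension less than `n`. -/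
lemma map_mem_of_not_surjective (hmin : ∀ m < n, ∀ y : K _⦋m⦌, y ∈ a.dom.obj _) {m}
    (t : (Δ[n] : SSet.{u}).obj m) (ht : ¬ Function.Surjective (stdSimplex.asOrderHom t)) :
    (yonedaEquiv.symm x).app m t ∈ a.dom.obj m := by
  obtain ⟨m⟩ := m
  let φ : m ⟶ ⦋n⦌ := stdSimplex.objEquiv t
  have h : (yonedaEquiv.symm x).app (op m) t = K.map φ.op x := rfl
  rw [h, ← Limits.image.fac φ, op_comp, K.map_comp_apply]
  refine a.dom.map _ (hmin _ ?_ _)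
  have h₁ := SimplexCategory.len_le_of_mono (Limits.image.ι φ)
  refine lt_of_le_of_ne h₁ fun h₂ => ht ?_
  have h₃ : Epi φ := by
    have : IsIso (Limits.image.ι φ) := (SimplexCategory.isIso_iff_of_mono _).2 h₂
    rw [← Limits.image.fac φ]
    infer_instance
  exact SimplexCategory.epi_iff_surjective.1 h₃

/-- A surjection of simplices has a section, and applying it to a degeneracy of `x` in the domain
would put `x` there too. -/
lemma map_mem_iff (hmin : ∀ m < n, ∀ y : K _⦋m⦌, y ∈ a.dom.obj _) (hx : x ∉ a.dom.obj _) {m}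
    (t : (Δ[n] : SSet.{u}).obj m) :
    (yonedaEquiv.symm x).app m t ∈ a.dom.obj m ↔
      ¬ Function.Surjective (stdSimplex.asOrderHom t) := by
  refine ⟨fun h hs => hx ?_, a.map_mem_of_not_surjective x hmin t⟩
  let φ : m.unop ⟶ ⦋n⦌ := stdSimplex.objEquiv t
  have : Epi φ := SimplexCategory.epi_iff_surjective.2 hs
  have := isSplitEpi_of_epi φ
  have h' : K.map φ.op x ∈ a.dom.obj m := h
  have := a.dom.map (section_ φ).op h'
  simpa [← Functor.map_comp_apply, ← op_comp] using this

lemma mem_nonDegenerate (hmin : ∀ m < n, ∀ y : K _⦋m⦌, y ∈ a.dom.obj _)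
    (hx : x ∉ a.dom.obj _) : x ∈ K.nonDegenerate n := by
  rintro ⟨m, hm, f, y, rfl⟩
  exact hx (a.dom.map _ (hmin m hm y))

/-- By minimality the boundary of `x` is already in the domain, so the cylinder domain pulls back to
the first stage of the prism. Filling the prism and gluing extends the lift. -/
lemma exists_cell_extension [InnerFibration p]
    (hmin : ∀ m < n, ∀ y : K _⦋m⦌, y ∈ a.dom.obj _) (hx : x ∉ a.dom.obj _)
    (hP : K.map (SimplexCategory.const ⦋0⦌ ⦋n⦌ 0).op x ∈ P)
    (hlift : ∀ k ∈ P, ∃ e : M _⦋1⦌, p.app _ e = yonedaEquiv (𝟙 Δ[1]) ∧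
      M.δ 1 e = a.map.app _ ⟨(k, vertex 0), cylVertex_mem _ k⟩ ∧ IsCocartesianEdge p e) :
    ∃ b : PartialLift p P, a ≤ b ∧ x ∈ b.dom.obj _ := by
  let τ : Δ[n] ⊗ Δ[1] ⟶ K ⊗ Δ[1] := yonedaEquiv.symm x ▷ Δ[1]
  have hτ : ∀ m (t : (Δ[n] ⊗ Δ[1] : SSet.{u}).obj m),
      τ.app m t ∈ (cyl a.dom).obj m ↔ t ∈ (prismStage n (n + 1)).obj m := by
    intro m t
    refine or_congr (a.map_mem_iff x hmin hx t.1) (forall_congr' fun i => ?_)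
    -- No vertex of `Δⁿ` is at least `n + 1`, so the second clause for this stage says that the
    -- `Δ¹`-coordinate is constantly `0`.
    have : ¬ n + 1 ≤ (stdSimplex.asOrderHom t.1 i).val :=
      not_le.2 (stdSimplex.asOrderHom t.1 i).isLt
    have aux : ∀ b : Fin 2, b = 0 ↔ ¬ b = 1 := by decide
    exact (aux _).trans ⟨fun h hi => absurd hi h, fun h hi => this (h hi)⟩
  let f₀ : (prismStage n (n + 1) : SSet.{u}) ⟶ (cyl a.dom : SSet.{u}) :=
    Subcomplex.lift ((prismStage n (n + 1)).ι ≫ τ) (by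
      rintro m _ ⟨t, rfl⟩
      exact (hτ m t.1).2 t.2)
  have hf : (f₀ ≫ a.map) ≫ p =
      (prismStage n (n + 1)).ι ≫ CartesianMonoidalCategory.snd _ _ := by
    rw [Category.assoc, a.map_comp]
    rfl
  have hF : ∃ F : Δ[n] ⊗ Δ[1] ⟶ M, F ≫ p = CartesianMonoidalCategory.snd _ _ ∧
      (∀ m z (hz : z ∈ (prismStage n (n + 1)).obj m), F.app m z = (f₀ ≫ a.map).app m ⟨z, hz⟩) ∧
      (n = 0 → IsCocartesianEdge p (F.app _ (prismEdge n))) := by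
    cases n with
    | zero =>
      obtain ⟨e, he, hef, hec⟩ := hlift _ hP
      obtain ⟨F, h₁, h₂, h₃⟩ := exists_prism_extension_zero p (f₀ ≫ a.map) e he hef hf
      exact ⟨F, h₁, h₂, fun _ => by rwa [h₃]⟩
    | succ n =>
      obtain ⟨F, h₁, h₂⟩ := exists_prism_extension_succ p n (f₀ ≫ a.map) hf (by
        have h₀ := hmin 0 (Nat.succ_pos _) (K.map (SimplexCategory.const ⦋0⦌ ⦋n + 1⦌ 0).op x)
        have := a.cocartesian _ hP h₀
        convert this using 1
        refine congrArg (a.map.app _) (Subtype.ext (Prod.ext ?_ rfl))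
        change _ = K.map _ (K.map _ x)
        rw [← K.map_comp_apply]
        rfl)
      exact ⟨F, h₁, h₂, fun h => absurd h (Nat.succ_ne_zero n)⟩
  obtain ⟨F, hF₁, hF₂, hF₃⟩ := hF
  have hle : a.dom ≤ a.dom ⊔ Subcomplex.ofSimplex x := le_sup_left
  have hmem : ∀ {m} (y : K.obj m), y ∈ (a.dom ⊔ Subcomplex.ofSimplex x).obj m →
      y ∈ a.dom.obj m ∨ ∃ t, (yonedaEquiv.symm x).app m t = y := by
    rintro m y (hy | ⟨φ, hy⟩)
    · exact Or.inl hy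
    · exact Or.inr ⟨stdSimplex.objEquiv.symm φ.unop, hy⟩
  have hcov : ∀ m z, z ∈ (cyl (a.dom ⊔ Subcomplex.ofSimplex x)).obj m →
      z ∈ (cyl a.dom).obj m ∨ ∃ t, τ.app m t = z := by
    rintro m z (hz | hz)
    · rcases hmem _ hz with h | ⟨t, h⟩
      · exact Or.inl (Or.inl h)
      · exact Or.inr ⟨(t, z.2), Prod.ext h rfl⟩
    · exact Or.inl (Or.inr hz)
  obtain ⟨f, h₁, h₂⟩ := exists_glue (cyl_mono hle) τ a.map F hcov (by
      intro m t t' ht h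
      have ht₁ : Function.Surjective (stdSimplex.asOrderHom t.1) := by
        by_contra hs
        exact ht (Or.inl ((a.map_mem_iff x hmin hx _).2 hs))
      have : Epi (stdSimplex.objEquiv t.1) := SimplexCategory.epi_iff_surjective.2 ht₁
      refine Prod.ext (stdSimplex.objEquiv.injective ?_)
        (congrArg (fun z : K.obj m × Δ[1].obj m => z.2) h)
      -- Eilenberg–Zilber: a simplex is a degeneracy of a nondegenerate one in only one way. This
      -- gives injectivity outside the old domain.
      exact unique_nonDegenerate_map K (K.map (stdSimplex.objEquiv t.1).op x)
        (stdSimplex.objEquiv t.1) ⟨x, a.mem_nonDegenerate x hmin hx⟩ rfl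
        (stdSimplex.objEquiv t'.1) ⟨x, a.mem_nonDegenerate x hmin hx⟩
        (congrArg (fun z : K.obj m × Δ[1].obj m => z.1) h))
    (fun m t ht => hF₂ m t ((hτ m t).1 ht))
  refine ⟨⟨_, f, ?_, ?_⟩, ⟨hle, h₁⟩, Or.inr (Subcomplex.mem_ofSimplex_obj x)⟩
  · refine hom_ext_apply fun m ⟨z, hz⟩ => ?_
    rcases hcov m z hz with hz' | ⟨t, rfl⟩
    · exact (congrArg (p.app m) (h₁ m z hz')).trans (congr_app_apply a.map_comp m ⟨z, hz'⟩)
    · exact (congrArg (p.app m) (h₂ m t hz)).trans (congr_app_apply hF₁ m t)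
  · intro k hkP hk
    by_cases hk' : k ∈ a.dom.obj _
    · rw [h₁ _ _ (cylEdge_mem hk')]
      exact a.cocartesian k hkP hk'
    · obtain ⟨t, rfl⟩ := (hmem _ hk).resolve_left hk'
      -- For `n > 0` all vertices are already in the domain, so a new vertex is the attached cell
      -- itself.
      obtain rfl : n = 0 := by
        by_contra hn
        exact hk' (hmin 0 (Nat.pos_of_ne_zero hn) _)
      have : cylEdge ((yonedaEquiv.symm x).app _ t) = τ.app _ (prismEdge 0) := by
        refine Prod.ext ?_ rfl
        refine (NatTrans.naturality_apply (yonedaEquiv.symm x) _ _).symm.trans (congrArg _ ?_)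
        apply asOrderHom_injective
        ext i : 2
        exact Subsingleton.elim (α := Fin 1) _ _
      convert hF₃ rfl using 1
      rw [← h₂ _ _ (this ▸ cylEdge_mem hk)]
      exact congrArg (f.app _) (Subtype.ext this)

end Cell

/-- The extension theorem for lifts of the cylinder, one nondegenerate simplex at a time. -/
theorem exists_extension [InnerFibration p] (a : PartialLift p P)
    (hP : ∀ n (x : K _⦋n⦌), x ∉ a.dom.obj _ → K.map (SimplexCategory.const ⦋0⦌ ⦋n⦌ 0).op x ∈ P)
    (hlift : ∀ k ∈ P, ∃ e : M _⦋1⦌, p.app _ e = yonedaEquiv (𝟙 Δ[1]) ∧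
      M.δ 1 e = a.map.app _ ⟨(k, vertex 0), cylVertex_mem _ k⟩ ∧ IsCocartesianEdge p e) :
    ∃ A : K ⊗ Δ[1] ⟶ M, A ≫ p = CartesianMonoidalCategory.snd _ _ ∧
      (∀ m z (hz : z ∈ (cyl a.dom).obj m), A.app m z = a.map.app m ⟨z, hz⟩) ∧
      ∀ k ∈ P, IsCocartesianEdge p (cylinderEdge A k) := by
  obtain ⟨b, hab, hb⟩ := zorn_le_nonempty_Ici₀ a
    (fun c _ hc y hy => exists_upper_bound c hc ⟨y, hy⟩) a le_rfl
  obtain ⟨hle, hagree⟩ := id hab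
  have htop : b.dom = ⊤ := by
    by_contra hne
    have hex : ∃ n, ∃ x : K _⦋n⦌, x ∉ b.dom.obj _ := by
      by_contra! h
      exact hne (top_le_iff.1 fun m x _ => h m.unop.len x)
    classical
    -- A missing simplex of least dimension contradicts the maximality of `b`.
    obtain ⟨x, hx⟩ := Nat.find_spec hex
    have hmin : ∀ m < Nat.find hex, ∀ y : K _⦋m⦌, y ∈ b.dom.obj _ := fun m hm y => by
      by_contra hy
      exact Nat.find_min hex hm ⟨y, hy⟩
    obtain ⟨c, hbc, hxc⟩ := b.exists_cell_extension x hmin hx (hP _ x fun h => hx (hle _ h))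
      fun k hk => by
        obtain ⟨e, h₁, h₂, h₃⟩ := hlift k hk
        exact ⟨e, h₁, h₂.trans (hagree _ _ _).symm, h₃⟩
    exact hx ((hb hbc).1 _ hxc)
  have hmem : ∀ m (z : (K ⊗ Δ[1]).obj m), z ∈ (cyl b.dom).obj m := fun m z =>
    Or.inl (by rw [htop]; trivial)
  have hr : Subcomplex.range (𝟙 (K ⊗ Δ[1])) ≤ cyl b.dom := fun m z _ => hmem m z
  refine ⟨Subcomplex.lift (𝟙 _) hr ≫ b.map, ?_, fun m z hz => hagree m z hz, fun k hk => ?_⟩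
  · rw [Category.assoc, b.map_comp]
    rfl
  · exact b.cocartesian k hk (by rw [htop]; trivial)

end PartialLift

end

/-! ### Fibres over `Δ¹` and existence of adjuncts -/

lemma mem_fiber_iff {K : SSet.{u}} (s : K ⟶ Δ[1]) (j : Fin 2) {m} (k : K.obj m) :
    k ∈ (fiber s j).obj m ↔ ∀ i, stdSimplex.asOrderHom (s.app m k) i = j := by
  constructor
  · rintro ⟨φ, hφ⟩ i
    rw [← hφ]
    rfl
  · intro h
    refine ⟨(m.unop.const ⦋0⦌ 0).op, asOrderHom_injective ?_⟩
    ext i : 2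
    exact (h i).symm

/-- A monotone sequence in `{0, 1}` that is not constantly `1` starts at `0`. Hence every cell to be
attached begins at a vertex where a cocartesian edge is available. -/
lemma mem_fiber_of_notMem {K : SSet.{u}} (s : K ⟶ Δ[1]) {n : ℕ} (x : K _⦋n⦌)
    (hx : x ∉ (fiber s 1).obj _) :
    K.map (SimplexCategory.const ⦋0⦌ ⦋n⦌ 0).op x ∈ (fiber s 0).obj _ := by
  rw [mem_fiber_iff] at hx ⊢
  intro i
  by_contra h
  apply hx
  intro j
  have h₀ : stdSimplex.asOrderHom (s.app _ (K.map (SimplexCategory.const ⦋0⦌ ⦋n⦌ 0).op x)) i =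
      stdSimplex.asOrderHom (s.app _ x) 0 := by
    rw [NatTrans.naturality_apply]
    rfl
  rw [h₀] at h
  have hmono := (stdSimplex.asOrderHom (s.app _ x)).monotone (Fin.zero_le j)
  have aux : ∀ a b : Fin 2, ¬ a = 0 → a ≤ b → b = 1 := by decide
  exact aux _ _ h hmono

lemma exists_of_mem_fiber {K K' : SSet.{u}} (s : K ⟶ Δ[1]) (i : K' ⟶ K)
    [IsIso (fiberMap i s 1)] {m} {k : K.obj m} (hk : k ∈ (fiber s 1).obj m) :
    ∃ k' ∈ (fiber (i ≫ s) 1).obj m, i.app m k' = k := by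
  let k' := (inv (fiberMap i s 1)).app m ⟨k, hk⟩
  have h : (fiberMap i s 1).app m k' = ⟨k, hk⟩ :=
    congr_app_apply (IsIso.inv_hom_id (fiberMap i s 1)) m ⟨k, hk⟩
  exact ⟨k'.1, k'.2, congrArg Subtype.val h⟩

namespace ClassifyingData

variable {C D M : SSet.{u}} {p : M ⟶ Δ[1]} {g : D ⟶ C} (H : ClassifyingData p g)

instance : Mono H.inr := by
  unfold inr
  infer_instance

lemma exists_target {K : SSet.{u}} (A : K ⊗ Δ[1] ⟶ M)
    (hA : A ≫ p = CartesianMonoidalCategory.snd K Δ[1]) :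
    ∃ β : K ⟶ D, SSet.ι₁ ≫ A = β ≫ H.inr := by
  have hr : Subcomplex.range (SSet.ι₁ ≫ A) ≤ fiber p 1 := by
    rintro m _ ⟨k, rfl⟩
    rw [mem_fiber_iff]
    intro i
    have : p.app m ((SSet.ι₁ ≫ A).app m k) = _ := congr_app_apply hA m (SSet.ι₁.app m k)
    rw [this]
    rfl
  refine ⟨Subcomplex.lift _ hr ≫ H.h₁.inv, ?_⟩
  simp [inr]

lemma inr_injective {m} {d d' : D.obj m} (h : H.inr.app m d = H.inr.app m d') : d = d' :=
  (mono_iff_injective _).1 ((NatTrans.mono_iff_mono_app H.inr).1 inferInstance m) h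

/-- This is the start of the extension: `A'` on `K' × Δ¹` and `α` on `K × {0}`. They agree on `K' ×
{0}` by `h₀`, and injectivity of `i` makes the union well defined. -/
lemma exists_initial_lift {K K' : SSet.{u}} (s : K ⟶ Δ[1]) (i : K' ⟶ K) [Mono i]
    (α : K ⟶ C) (A' : K' ⊗ Δ[1] ⟶ M) (hA' : A' ≫ p = CartesianMonoidalCategory.snd K' Δ[1])
    (h₀ : SSet.ι₀ ≫ A' = (i ≫ α) ≫ H.inl)
    (hc : ∀ k ∈ (fiber (i ≫ s) 0).obj (op ⦋0⦌), IsCocartesianEdge p (cylinderEdge A' k)) :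
    ∃ a : PartialLift p ((fiber s 0).obj (op ⦋0⦌)), a.dom = Subcomplex.range i ∧
      (∀ m k t (h : (i.app m k, t) ∈ (cyl a.dom).obj m),
        a.map.app m ⟨(i.app m k, t), h⟩ = A'.app m (k, t)) ∧
      ∀ m k (h : SSet.ι₀.app m k ∈ (cyl a.dom).obj m),
        a.map.app m ⟨SSet.ι₀.app m k, h⟩ = H.inl.app m (α.app m k) := by
  have hinj : ∀ {m} {k k' : K'.obj m}, i.app m k = i.app m k' → k = k' := fun h =>
    (mono_iff_injective _).1 ((NatTrans.mono_iff_mono_app i).1 inferInstance _) h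
  have hι : ∀ {X : SSet.{u}} {m} (z : (X ⊗ Δ[1] : SSet.{u}).obj m),
      (∀ i, stdSimplex.asOrderHom z.2 i = 0) → z = SSet.ι₀.app m z.1 := by
    intro X m z hz
    refine Prod.ext rfl (asOrderHom_injective ?_)
    ext i : 2
    exact hz i
  obtain ⟨f, hf⟩ := exists_hom_of_rel (X := (cyl (Subcomplex.range i) : SSet.{u})) (M := M)
    (fun n z m => (∃ k, i.app n k = z.1.1 ∧ A'.app n (k, z.1.2) = m) ∨
      ((∀ i, stdSimplex.asOrderHom z.1.2 i = 0) ∧ H.inl.app n (α.app n z.1.1) = m))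
    (by
      rintro n ⟨⟨k, t⟩, ⟨k', h⟩ | h⟩
      · exact ⟨_, Or.inl ⟨k', h, rfl⟩⟩
      · exact ⟨_, Or.inr ⟨h, rfl⟩⟩)
    (by
      have aux : ∀ n (k : K'.obj n) (t : Δ[1].obj n), (∀ i, stdSimplex.asOrderHom t i = 0) →
          A'.app n (k, t) = H.inl.app n (α.app n (i.app n k)) := by
        intro n k t ht
        rw [hι (X := K') (k, t) ht]
        exact congr_app_apply h₀ n k
      rintro n ⟨⟨k, t⟩, h⟩ m m' (⟨k₁, rfl, rfl⟩ | ⟨h₁, rfl⟩) (⟨k₂, h₂, rfl⟩ | ⟨h₂, rfl⟩)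
      · rw [hinj h₂]
      · exact aux _ _ _ h₂
      · dsimp only at h₂
        subst h₂
        exact (aux _ _ _ h₁).symm
      · rfl)
    (by
      rintro n n' φ ⟨⟨k, t⟩, h⟩ m (⟨k', h₁, rfl⟩ | ⟨h₁, rfl⟩)
      · refine Or.inl ⟨K'.map φ k', ?_, ?_⟩
        swap; · exact NatTrans.naturality_apply A' φ (show (K' ⊗ Δ[1] : SSet.{u}).obj n from (k', t))
        rw [NatTrans.naturality_apply, h₁]
        rfl
      · refine Or.inr ⟨fun j => h₁ _, ?_⟩
        exact NatTrans.naturality_apply (α ≫ H.inl) φ k)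
  have hf₁ : ∀ m k t (h : (i.app m k, t) ∈ (cyl (Subcomplex.range i)).obj m),
        f.app m ⟨(i.app m k, t), h⟩ = A'.app m (k, t) := by
    intro m k t h
    rcases hf m ⟨_, h⟩ with ⟨k', h₁, h₂⟩ | ⟨h₁, h₂⟩
    · rw [← h₂, hinj h₁]
    · rw [← h₂, hι (X := K') (k, t) h₁]
      exact (congr_app_apply h₀ m k).symm
  have hf₀ : ∀ m k (h : SSet.ι₀.app m k ∈ (cyl (Subcomplex.range i)).obj m),
        f.app m ⟨SSet.ι₀.app m k, h⟩ = H.inl.app m (α.app m k) := by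
    intro m k h
    rcases hf m ⟨_, h⟩ with ⟨k', h₁, h₂⟩ | ⟨h₁, h₂⟩
    · rw [← h₂]
      have h₁ : i.app m k' = k := h₁
      subst h₁
      exact congr_app_apply h₀ m k'
    · exact h₂.symm
  refine ⟨⟨Subcomplex.range i, f, ?_, ?_⟩, rfl, hf₁, hf₀⟩
  · refine hom_ext_apply fun m ⟨⟨k, t⟩, hz⟩ => ?_
    by_cases ht : ∀ i, stdSimplex.asOrderHom t i = 0
    · have h₁ : ((k, t) : (K ⊗ Δ[1] : SSet.{u}).obj m) = SSet.ι₀.app m k := hι (X := K) (k, t) ht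
      have h₂ : f.app m ⟨(k, t), hz⟩ = H.inl.app m (α.app m k) := by
        rw [← hf₀ m k (h₁ ▸ hz)]
        exact congrArg (f.app m) (Subtype.ext h₁)
      refine (congrArg (p.app m) h₂).trans (asOrderHom_injective ?_)
      ext j : 2
      refine Eq.trans ?_ (ht j).symm
      exact (mem_fiber_iff p 0 _).1 (H.h₀.hom.app m (α.app m k)).2 j
    · obtain ⟨k', rfl⟩ := hz.resolve_right ht
      exact (congrArg (p.app m) (hf₁ m k' t hz)).trans (congr_app_apply hA' m (k', t))
  · rintro _ hkP ⟨k, rfl⟩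
    have h₁ : cylEdge (i.app _ k) = (i ▷ Δ[1]).app _ (cylEdge k) :=
      Prod.ext (NatTrans.naturality_apply i _ _).symm rfl
    have h₂ : f.app _ ⟨cylEdge (i.app _ k), cylEdge_mem ⟨k, rfl⟩⟩ = cylinderEdge A' k := by
      refine Eq.trans (congrArg (f.app _) (Subtype.ext h₁)) (hf₁ _ _ _ ?_)
      exact Or.inl ⟨_, rfl⟩
    rw [h₂]
    exact hc k hkP

theorem exists_isAdjunct [InnerFibration p] {K K' : SSet.{u}} (s : K ⟶ Δ[1]) (i : K' ⟶ K) [Mono i]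
    [IsIso (fiberMap i s 1)] (α : K ⟶ C) (β' : K' ⟶ D) (hβ' : H.IsAdjunct (i ≫ s) (i ≫ α) β')
    (hα : ∀ k ∈ (fiber s 0).obj (op ⦋0⦌), H.AdmitsLeftAdjointAt (α.app _ k)) :
    ∃ β : K ⟶ D, i ≫ β = β' ∧ H.IsAdjunct s α β := by
  obtain ⟨A', hA', h₀, h₁, hc, hv⟩ := hβ'
  obtain ⟨a, ha, ha₁, ha₀⟩ := H.exists_initial_lift s i α A' hA' h₀ hc
  obtain ⟨A, hA, hAa, hAc⟩ := a.exists_extension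
    (fun n x hx => mem_fiber_of_notMem s x fun h => hx (by
      obtain ⟨k', -, rfl⟩ := exists_of_mem_fiber s i h
      rw [ha]
      exact ⟨k', rfl⟩))
    (fun k hk => by
      obtain ⟨e, he, he', hec⟩ := hα k hk
      refine ⟨e, he, he'.trans ?_, hec⟩
      rw [← ha₀ _ k (Or.inr fun _ => rfl)]
      exact congrArg (a.map.app _) (Subtype.ext (Prod.ext rfl (by ext i; rfl))))
  have hAi : ∀ m k t, A.app m (i.app m k, t) = A'.app m (k, t) := fun m k t => by
    have hmem : (i.app m k, t) ∈ (cyl a.dom).obj m := Or.inl (by rw [ha]; exact ⟨k, rfl⟩)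
    exact (hAa m _ hmem).trans (ha₁ m k t hmem)
  obtain ⟨β, hβ⟩ := H.exists_target A hA
  have hiβ : i ≫ β = β' := by
    rw [← cancel_mono H.inr, Category.assoc, ← hβ, ← h₁]
    exact hom_ext_apply fun m k => hAi m k _
  refine ⟨β, hiβ, A, hA, ?_, hβ, hAc, ?_⟩
  · refine hom_ext_apply fun m k => ?_
    have hmem : SSet.ι₀.app m k ∈ (cyl a.dom).obj m := Or.inr fun _ => rfl
    exact (hAa m _ hmem).trans (ha₀ m k hmem)
  -- Simplices of `K₁` come from `K'`, where the formula through `v` holds for `A'`.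
  · refine hom_ext_apply fun m ⟨⟨k, hk⟩, t⟩ => ?_
    obtain ⟨k', hk', rfl⟩ := exists_of_mem_fiber s i hk
    have : β.app m (i.app m k') = β'.app m k' := congr_app_apply hiβ m k'
    refine (hAi m k' t).trans ((congr_app_apply hv m (⟨k', hk'⟩, t)).trans ?_)
    change H.v.app m (β'.app m k', t) = H.v.app m (β.app m (i.app m k'), t)
    rw [this]

end ClassifyingData

/-! ### Uniqueness -/

/-- This identifies the endpoints of the path in `Fun(K, D)` transposed from a homotopy parametrised
by `J`. -/
lemma curry_app_eq_funVertex {K D J : SSet.{u}} (h : K ⊗ J ⟶ D) (j : J _⦋0⦌) (f : K ⟶ D)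
    (hf : CartesianMonoidalCategory.lift (𝟙 K) (SSet.const j) ≫ h = f) :
    (MonoidalClosed.curry h).app _ j = funVertex f := by
  apply (SSet.unitHomEquiv _).symm.injective
  unfold funVertex
  rw [Equiv.symm_apply_apply]
  have : (SSet.unitHomEquiv _).symm ((MonoidalClosed.curry h).app _ j) =
      (SSet.unitHomEquiv J).symm j ≫ MonoidalClosed.curry h := by
    apply (SSet.unitHomEquiv _).injective
    rw [Equiv.apply_symm_apply]
    change _ = (MonoidalClosed.curry h).app _ ((SSet.unitHomEquiv J) ((SSet.unitHomEquiv J).symm j))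
    rw [Equiv.apply_symm_apply]
  rw [this, ← MonoidalClosed.curry_natural_left]
  unfold MonoidalClosed.curry'
  congr 1
  rw [← hf]
  rfl

lemma funEquivalent_of_hom {K D : SSet.{u}} (h : K ⊗ coherentIso.{u} ⟶ D) (f₁ f₂ : K ⟶ D)
    (h₁ : CartesianMonoidalCategory.lift (𝟙 K) (SSet.const coherentIso.x₀) ≫ h = f₁)
    (h₂ : CartesianMonoidalCategory.lift (𝟙 K) (SSet.const coherentIso.x₁) ≫ h = f₂) :
    FunEquivalent f₁ f₂ :=
  ⟨(coherentIso.hom.map (MonoidalClosed.curry h)).ofEq (curry_app_eq_funVertex h _ _ h₁)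
    (curry_app_eq_funVertex h _ _ h₂), ⟨(coherentIso.invStructHom.map _).ofEq rfl⟩⟩

/-- This makes `K × {x₀}` and `K × {x₁}` disjoint, so data on the two ends need no compatibility. -/
lemma coherentIso_const_ne {m : SimplexCategoryᵒᵖ} :
    coherentIso.{u}.map (m.unop.const ⦋0⦌ 0).op coherentIso.x₀ ≠
      coherentIso.{u}.map (m.unop.const ⦋0⦌ 0).op coherentIso.x₁ := by
  intro h
  have := congrArg (fun F : ComposableArrows WalkingIso.{u} m.unop.len => (F.obj 0).as.down) h
  exact Bool.noConfusion this

lemma map_const_apply {J : SSet.{u}} (x : J _⦋0⦌) {m m' : SimplexCategoryᵒᵖ} (φ : m ⟶ m') :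
    J.map φ (J.map (m.unop.const ⦋0⦌ 0).op x) = J.map (m'.unop.const ⦋0⦌ 0).op x := by
  rw [← J.map_comp_apply]
  rfl

/-- The subcomplex `K₁ × J ∪ K × {x₀, x₁}` of `K × J`, for `J` the coherent isomorphism. -/
def isoBoundary {K : SSet.{u}} (s : K ⟶ Δ[1]) : (K ⊗ coherentIso.{u}).Subcomplex where
  obj m := Set.ofPred (fun z : K.obj m × coherentIso.{u}.obj m =>
    (z.1 ∈ (fiber s 1).obj m ∨ z.2 = coherentIso.map (m.unop.const ⦋0⦌ 0).op coherentIso.x₀) ∨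
      z.2 = coherentIso.map (m.unop.const ⦋0⦌ 0).op coherentIso.x₁)
  map {m m'} φ z := by
    rintro ((h | h) | h)
    · exact Or.inl (Or.inl ((fiber s 1).map φ h))
    · exact Or.inl (Or.inr ((congrArg (coherentIso.map φ) h).trans (map_const_apply _ φ)))
    · exact Or.inr ((congrArg (coherentIso.map φ) h).trans (map_const_apply _ φ))

/-- The fibre of `K × J` over `1` is `K₁ × J`, which the subcomplex contains by construction. -/
instance isIso_fiberMap_isoBoundary {K : SSet.{u}} (s : K ⟶ Δ[1]) :
    IsIso (fiberMap (isoBoundary s).ι (CartesianMonoidalCategory.fst _ _ ≫ s) 1) := by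
  refine ⟨Subcomplex.lift (Subcomplex.lift (fiber _ 1).ι ?_) ?_, rfl, rfl⟩
  · rintro m _ ⟨z, rfl⟩
    exact Or.inl (Or.inl z.2)
  · rintro m _ ⟨z, rfl⟩
    exact z.2

namespace ClassifyingData

variable {C D M : SSet.{u}} {p : M ⟶ Δ[1]} {g : D ⟶ C} (H : ClassifyingData p g)

/-- The witness is `A₁` on `K₁ × J ∪ K × {x₀}` and `A₂` on `K × {x₁}`, each composed with the
projection away from `J`. The overlap lies over `K₁`. -/
lemma exists_isAdjunct_isoBoundary {K : SSet.{u}} {s : K ⟶ Δ[1]} {α : K ⟶ C} {β₁ β₂ : K ⟶ D}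
    (h₁ : H.IsAdjunct s α β₁) (h₂ : H.IsAdjunct s α β₂)
    (h₁₂ : (fiber s 1).ι ≫ β₁ = (fiber s 1).ι ≫ β₂) :
    ∃ β : (isoBoundary s : SSet.{u}) ⟶ D,
      H.IsAdjunct ((isoBoundary s).ι ≫ CartesianMonoidalCategory.fst _ _ ≫ s)
        ((isoBoundary s).ι ≫ CartesianMonoidalCategory.fst _ _ ≫ α) β ∧
      (∀ m (k : K.obj m) j (h : (k, j) ∈ (isoBoundary s).obj m),
        j = coherentIso.map (m.unop.const ⦋0⦌ 0).op coherentIso.x₀ →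
          β.app m ⟨(k, j), h⟩ = β₁.app m k) ∧
      ∀ m (k : K.obj m) j (h : (k, j) ∈ (isoBoundary s).obj m),
        j = coherentIso.map (m.unop.const ⦋0⦌ 0).op coherentIso.x₁ →
          β.app m ⟨(k, j), h⟩ = β₂.app m k := by
  obtain ⟨A₁, hp₁, hα₁, hβ₁, hc₁, hv₁⟩ := h₁
  obtain ⟨A₂, hp₂, hα₂, hβ₂, hc₂, hv₂⟩ := h₂
  have hA : ∀ m (k : K.obj m) t, k ∈ (fiber s 1).obj m → A₁.app m (k, t) = A₂.app m (k, t) := by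
    intro m k t hk
    -- Over `K₁` the witness is determined by `v` and the adjunct, and the two adjuncts agree there.
    rw [h₁₂, ← hv₂] at hv₁
    exact congr_app_apply hv₁ m (⟨k, hk⟩, t)
  let R : ∀ n, ((isoBoundary s : SSet.{u}) ⊗ Δ[1]).obj n → M.obj n → Prop := fun n z m =>
    ((z.1.1.1 ∈ (fiber s 1).obj n ∨
        z.1.1.2 = coherentIso.map (n.unop.const ⦋0⦌ 0).op coherentIso.x₀) ∧
      A₁.app n (z.1.1.1, z.2) = m) ∨
    (z.1.1.2 = coherentIso.map (n.unop.const ⦋0⦌ 0).op coherentIso.x₁ ∧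
      A₂.app n (z.1.1.1, z.2) = m)
  have hR : ∀ n x m m', R n x m → R n x m' → m = m' := by
    have aux : ∀ n (k : K.obj n) (j : coherentIso.{u}.obj n) t, (k ∈ (fiber s 1).obj n ∨
        j = coherentIso.map (n.unop.const ⦋0⦌ 0).op coherentIso.x₀) →
        j = coherentIso.map (n.unop.const ⦋0⦌ 0).op coherentIso.x₁ →
        A₁.app n (k, t) = A₂.app n (k, t) := by
      rintro n k j t (hk | rfl) h
      · exact hA n k t hk
      · exact absurd h coherentIso_const_ne
    rintro n ⟨⟨⟨k, j⟩, hz⟩, t⟩ m m' (⟨h₁, rfl⟩ | ⟨h₁, rfl⟩) (⟨h₂, rfl⟩ | ⟨h₂, rfl⟩)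
    · rfl
    · exact aux n k j t h₁ h₂
    · exact (aux n k j t h₂ h₁).symm
    · rfl
  obtain ⟨A, hRA⟩ := exists_hom_of_rel R
    (by
      rintro n ⟨⟨⟨k, j⟩, h | h⟩, t⟩
      · exact ⟨_, Or.inl ⟨h, rfl⟩⟩
      · exact ⟨_, Or.inr ⟨h, rfl⟩⟩) hR
    (by
      rintro n n' φ ⟨⟨⟨k, j⟩, hz⟩, t⟩ m (⟨h, rfl⟩ | ⟨h, rfl⟩)
      · refine Or.inl ⟨h.imp (fun h => (fiber s 1).map φ h) fun h =>
          (congrArg (coherentIso.map φ) h).trans (map_const_apply _ φ), ?_⟩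
        exact NatTrans.naturality_apply A₁ φ (show (K ⊗ Δ[1] : SSet.{u}).obj n from (k, t))
      · refine Or.inr ⟨(congrArg (coherentIso.map φ) h).trans (map_const_apply _ φ), ?_⟩
        exact NatTrans.naturality_apply A₂ φ (show (K ⊗ Δ[1] : SSet.{u}).obj n from (k, t)))
  have hA₁ : ∀ n (z : (isoBoundary s : SSet.{u}).obj n) t, (z.1.1 ∈ (fiber s 1).obj n ∨
      z.1.2 = coherentIso.map (n.unop.const ⦋0⦌ 0).op coherentIso.x₀) →
      A.app n (z, t) = A₁.app n (z.1.1, t) :=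
    fun n z t h => hR n _ _ _ (hRA n (z, t)) (Or.inl ⟨h, rfl⟩)
  have hA₂ : ∀ n (z : (isoBoundary s : SSet.{u}).obj n) t,
      z.1.2 = coherentIso.map (n.unop.const ⦋0⦌ 0).op coherentIso.x₁ →
      A.app n (z, t) = A₂.app n (z.1.1, t) :=
    fun n z t h => hR n _ _ _ (hRA n (z, t)) (Or.inr ⟨h, rfl⟩)
  have hAp : A ≫ p = CartesianMonoidalCategory.snd _ _ := by
    refine hom_ext_apply fun m ⟨z, t⟩ => ?_
    rcases z.2 with h | h
    · exact (congrArg (p.app m) (hA₁ m z t h)).trans (congr_app_apply hp₁ m (z.1.1, t))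
    · exact (congrArg (p.app m) (hA₂ m z t h)).trans (congr_app_apply hp₂ m (z.1.1, t))
  obtain ⟨β, hβ⟩ := H.exists_target A hAp
  have hβ₁' : ∀ n (z : (isoBoundary s : SSet.{u}).obj n), (z.1.1 ∈ (fiber s 1).obj n ∨
      z.1.2 = coherentIso.map (n.unop.const ⦋0⦌ 0).op coherentIso.x₀) →
      β.app n z = β₁.app n z.1.1 := fun n z h => H.inr_injective
    ((congr_app_apply hβ n z).symm.trans ((hA₁ n z _ h).trans (congr_app_apply hβ₁ n z.1.1)))
  refine ⟨β, ⟨A, hAp, ?_, hβ, ?_, ?_⟩, fun m k j h hj => hβ₁' m ⟨(k, j), h⟩ (Or.inr hj),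
    fun m k j h hj => H.inr_injective
    ((congr_app_apply hβ m ⟨(k, j), h⟩).symm.trans
      ((hA₂ m ⟨(k, j), h⟩ _ hj).trans (congr_app_apply hβ₂ m k)))⟩
  · refine hom_ext_apply fun m z => ?_
    rcases z.2 with h | h
    · exact (hA₁ m z _ h).trans (congr_app_apply hα₁ m z.1.1)
    · exact (hA₂ m z _ h).trans (congr_app_apply hα₂ m z.1.1)
  · intro z hz
    have hφ := (isoBoundary s).map (SimplexCategory.const ⦋1⦌ ⦋0⦌ 0).op z.2
    rcases z.2 with h | h
    · have : cylinderEdge A z = cylinderEdge A₁ z.1.1 := by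
        refine hA₁ _ ⟨_, hφ⟩ _ (h.imp (fun h => (fiber s 1).map _ h) fun h => ?_)
        exact (congrArg (coherentIso.map _) h).trans (map_const_apply _ _)
      rw [this]
      exact hc₁ _ hz
    · have : cylinderEdge A z = cylinderEdge A₂ z.1.1 := by
        refine hA₂ _ ⟨_, hφ⟩ _ ?_
        exact (congrArg (coherentIso.map _) h).trans (map_const_apply _ _)
      rw [this]
      exact hc₂ _ hz
  · refine hom_ext_apply fun m ⟨⟨z, hz⟩, t⟩ => ?_
    have hz' : z.1.1 ∈ (fiber s 1).obj m := hz
    refine (hA₁ m z t (Or.inl hz')).trans ((congr_app_apply hv₁ m (⟨z.1.1, hz'⟩, t)).trans ?_)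
    change H.v.app m (β₁.app m z.1.1, t) = H.v.app m (β.app m z, t)
    rw [hβ₁' m z (Or.inl hz')]

/-- Existence over `K × J`, with `α` composed with the projection, extends the boundary datum to a
homotopy. The left adjoint condition at a vertex `(k, j)` is the one at `k`. -/
theorem funEquivalent_of_isAdjunct [InnerFibration p] {K : SSet.{u}} {s : K ⟶ Δ[1]} {α : K ⟶ C}
    {β₁ β₂ : K ⟶ D} (h₁ : H.IsAdjunct s α β₁) (h₂ : H.IsAdjunct s α β₂)
    (h₁₂ : (fiber s 1).ι ≫ β₁ = (fiber s 1).ι ≫ β₂)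
    (hα : ∀ k ∈ (fiber s 0).obj (op ⦋0⦌), H.AdmitsLeftAdjointAt (α.app _ k)) :
    FunEquivalent β₁ β₂ := by
  obtain ⟨β', hβ', hx₀, hx₁⟩ := H.exists_isAdjunct_isoBoundary h₁ h₂ h₁₂
  obtain ⟨β, hβ, -⟩ := H.exists_isAdjunct (CartesianMonoidalCategory.fst _ _ ≫ s) (isoBoundary s).ι
    (CartesianMonoidalCategory.fst _ _ ≫ α) β' hβ' fun k hk => hα k.1 hk
  refine funEquivalent_of_hom β β₁ β₂ ?_ ?_
  · refine hom_ext_apply fun m k => ?_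
    exact (congr_app_apply hβ m ⟨_, Or.inl (Or.inr rfl)⟩).trans (hx₀ m k _ _ rfl)
  · refine hom_ext_apply fun m k => ?_
    exact (congr_app_apply hβ m ⟨_, Or.inr rfl⟩).trans (hx₁ m k _ _ rfl)

end ClassifyingData

end AdjunctData

/-! ### The proposition -/

theorem mainTheorem4 {C D M K K' : SSet.{u}} [SSet.Quasicategory C] [SSet.Quasicategory D]
    (g : D ⟶ C) (p : M ⟶ Δ[1]) (hp : AdjunctData.IsCartesianFibration p)
    (H : AdjunctData.ClassifyingData p g)
    (s : K ⟶ Δ[1]) (i : K' ⟶ K) (hi : Mono i) (hi₁ : IsIso (AdjunctData.fiberMap i s 1))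
    (α : K ⟶ C) (β' : K' ⟶ D) (hβ' : H.IsAdjunct (i ≫ s) (i ≫ α) β')
    (hα : ∀ k ∈ (AdjunctData.fiber s 0).obj (op ⦋0⦌), H.AdmitsLeftAdjointAt (α.app _ k)) :
    (∃ β : K ⟶ D, i ≫ β = β' ∧ H.IsAdjunct s α β) ∧
      ∀ β₁ β₂ : K ⟶ D, i ≫ β₁ = β' → H.IsAdjunct s α β₁ → i ≫ β₂ = β' → H.IsAdjunct s α β₂ →
        AdjunctData.FunEquivalent β₁ β₂ := by
  have := hp.innerFibration
  refine ⟨H.exists_isAdjunct s i α β' hβ' hα, fun β₁ β₂ h₁ hA₁ h₂ hA₂ =>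
    H.funEquivalent_of_isAdjunct hA₁ hA₂ (AdjunctData.hom_ext_apply fun m ⟨k, hk⟩ => ?_) hα⟩
  -- Both maps restrict to `β'` along `i`, whose image contains `K₁`, so they agree on `K₁`.
  obtain ⟨k', -, rfl⟩ := AdjunctData.exists_of_mem_fiber s i hk
  exact AdjunctData.congr_app_apply (h₁.trans h₂.symm) m k'
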